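/- Let $\mathcal Z$ be a finite alphabet with $|\mathcal Z|>1$, and write $\log$ for the logarithm to base $2$. Consider the directed acyclic network with sources $s_1,s_2,s_3$, terminal $t$ and edges $(s_3,s_1),(s_3,s_2),(s_1,t),(s_2,t)$. For $k\ge 1$ the sources observe independent vectors $\mathbf X_1,\mathbf X_2,\mathbf X_3\in\{0,1\}^k$ with i.i.d. Bernoulli$(1/2)$ entries, $s_3$ forwards $\mathbf X_3$ to $s_1$ and $s_2$, and $t$ wants the componentwise integer sum $\mathbf\Sigma=\mathbf X_1+\mathbf X_2+\mathbf X_3\in\{0,1,2,3\}^k$. A variable-length $(k,N)$ network code over $\mathcal Z$ consists of encoding functions $\phi_1,\phi_2:\{0,1\}^k\times\{0,1\}^k\to\mathcal Z^\ast$ (finite sequences), giving $\mathbf Z_1=\phi_1(\mathbf X_1,\mathbf X_3)$ and $\mathbf Z_2=\phi_2(\mathbf X_2,\mathbf X_3)$; a random variable $N$ with values in the nonnegative integers, not exceeding the lengths of $\mathbf Z_1$ and $\mathbf Z_2$, that is a stopping time (for every $n$ the indicator of $\{N=n\}$ is a function of the first $n$ symbols of $\mathbf Z_1$ and of $\mathbf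 Z_2$); and a decoding function $\psi$ producing the estimate $\hat{\mathbf\Sigma}=\psi(\mathbf Z_1^N,\mathbf Z_2^N)\in\{0,1,2,3\}^k$ from the first $N$ symbols of each sequence. The code is zero-error if $\Pr(\hat{\mathbf\Sigma}\ne\mathbf\Sigma)=0$; its rate is $k/(\mathrm E N\,\log|\mathcal Z|)$. The capacity $\mathcal C$ is the supremum of the rates of all zero-error $(k,N)$ network codes over $\mathcal Z$, over all $k\ge1$. Let $H(N)$ be the Shannon entropy of $N$ in bits. Then: 1. For every $k\ge1$, every zero-error $(k,N)$ network code satisfies $\mathrm E N>0$ and $$\frac{k}{\mathrm E N\,\log|\mathcal Z|}\le\frac{H(N)}{\mathrm E N\,\log|\mathcal Z|}+\frac{2}{2.25}.$$ 2. For every $\varepsilon>0$ there is a $K\ge 1$, depending only on $\varepsilon$ and $\mathcal Z$, such that $H(N)/\mathrm E N\le\varepsilon$ for every $k\ge K$ and every zero-error $(k,N)$ network code. 3. $\mathcal C\le 8/9$. -/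

import Mathlib

open MeasureTheory ProbabilityTheory

/-- An outcome of the three binary sources over `k` time instants:
`x j i` is the `i`-th bit observed by source `s_{j+1}`, for `j = 0, 1, 2`. -/
abbrev SourceInput (k : ℕ) : Type := Fin 3 → Fin k → Fin 2

/-- The law of the sources: all `3 * k` bits are independent and Bernoulli with parameter `1/2`. -/
noncomputable def sourceLaw (k : ℕ) : Measure (SourceInput k) :=
  Measure.pi fun _ => Measure.pi fun _ =>
    bernoulliMeasure (1 : Fin 2) (0 : Fin 2) ⟨1 / 2, by norm_num, by norm_num⟩

/-- The componentwise arithmetic sum (in the integers) of the three source vectors,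
an element of `{0, 1, 2, 3}^k`. -/
def arithSum {k : ℕ} (x : SourceInput k) : Fin k → Fin 4 := fun i =>
  ⟨(x 0 i).val + (x 1 i).val + (x 2 i).val, by omega⟩

/-- A variable-length `(k, N)` network code over the alphabet `Z` for the network with edges
`(s₃, s₁)`, `(s₃, s₂)`, `(s₁, t)`, `(s₂, t)`, where `s₃` forwards its data to `s₁` and `s₂`. -/
structure NetworkCode (Z : Type*) (k : ℕ) where
  /-- Encoding function of the edge `(s₁, t)`, applied to the data of `s₁` and of `s₃`. -/
  enc₁ : (Fin k → Fin 2) → (Fin k → Fin 2) → List Z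
  /-- Encoding function of the edge `(s₂, t)`, applied to the data of `s₂` and of `s₃`. -/
  enc₂ : (Fin k → Fin 2) → (Fin k → Fin 2) → List Z
  /-- The random variable `N`, the time at which the terminal stops. -/
  stopTime : SourceInput k → ℕ
  /-- The first `N` symbols exist on the edge `(s₁, t)`. -/
  stopTime_le₁ : ∀ x, stopTime x ≤ (enc₁ (x 0) (x 2)).length
  /-- The first `N` symbols exist on the edge `(s₂, t)`. -/
  stopTime_le₂ : ∀ x, stopTime x ≤ (enc₂ (x 1) (x 2)).length
  /-- `N` is a stopping time: the indicator of `N = n` is a function of the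
  first `n` symbols received on the two edges. -/
  isStopping : ∀ n, ∃ f : List Z → List Z → Prop, ∀ x,
    stopTime x = n ↔ f ((enc₁ (x 0) (x 2)).take n) ((enc₂ (x 1) (x 2)).take n)
  /-- Decoding function of the terminal, applied to the first `N` symbols of the two edges. -/
  dec : List Z → List Z → Fin k → Fin 4

namespace NetworkCode

variable {Z : Type*} {k : ℕ}

/-- The terminal's estimate of the arithmetic sum. -/
def estimate (c : NetworkCode Z k) (x : SourceInput k) : Fin k → Fin 4 :=
  c.dec ((c.enc₁ (x 0) (x 2)).take (c.stopTime x)) ((c.enc₂ (x 1) (x 2)).take (c.stopTime x))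

/-- The code recovers the arithmetic sum with zero error. -/
def ZeroError (c : NetworkCode Z k) : Prop :=
  sourceLaw k {x | c.estimate x ≠ arithSum x} = 0

/-- The expected stopping time `E N`. -/
noncomputable def expTime (c : NetworkCode Z k) : ℝ :=
  ∫ x, (c.stopTime x : ℝ) ∂(sourceLaw k)

/-- The Shannon entropy `H(N)` of the stopping time, in bits
(only finitely many terms of the sum are nonzero). -/
noncomputable def entropyTime (c : NetworkCode Z k) : ℝ :=
  ∑' n : ℕ, -((sourceLaw k).real {x | c.stopTime x = n} *
    Real.logb 2 ((sourceLaw k).real {x | c.stopTime x = n}))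

/-- The rate `k / (E N * log |Z|)`, logarithm to the base `2`. -/
noncomputable def rate [Fintype Z] (c : NetworkCode Z k) : ℝ :=
  (k : ℝ) / (c.expTime * Real.logb 2 (Fintype.card Z))

end NetworkCode

/-- The computing capacity: the supremum, in the extended reals, of the rates of all
zero-error `(k, N)` network codes over the alphabet `Z`, over all block lengths `k ≥ 1`. -/
noncomputable def computingCapacity (Z : Type*) [Fintype Z] : EReal :=
  sSup {r : EReal | ∃ k : ℕ, 0 < k ∧ ∃ c : NetworkCode Z k, c.ZeroError ∧ r = ((c.rate : ℝ) : EReal)}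

/-!
Fix a zero-error code and let `W = word` be the pair of received words cut at time `N`, read as a
word of length `N` over `Z × Z`. Since `N` is a stopping time, the values of `W` form a prefix
code (`word_eq_of_prefix`), so Kraft's inequality gives `∑ w, |Z| ^ (-2 |w|) ≤ 1`.

The word `W` determines the sum `Σ`. Together with the vector `X₃` it determines all sources
(`ZeroError.eq_of_word_eq`): if `W` agrees on `(x₁, x₂, x₃)` and `(y₁, y₂, x₃)`, it takes the same
value on `(x₁, y₂, x₃)`, and decoding forces `x₂ = y₂` and then `x₁ = y₁`. As `X₃` is ambiguous
given `Σ` only at the coordinates where `Σ` is `1` or `2`, each fibre of `W` has at most `2 ^ m`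
points, `m` being the number of these coordinates. Each value of `W` therefore has
probability at most `2 ^ (m - 3 k)`, and `E m = 3 k / 4`. Comparing with Kraft's inequality through
`log y ≤ y - 1` gives `2 E N log |Z| ≥ 3 k - 3 k / 4 = 2.25 k` (`ZeroError.le_expTime`).

Thus every rate is at most `8 / 9`, whatever the block length, which settles the capacity bound;
the first bound follows as well because `H(N) ≥ 0`. For the ratio `H(N) / E N`, Gibbs' inequality
against a geometric law of parameter `1 - r` gives
`H(N) ≤ E N log (1 / r) + log (1 / (1 - r))` (`entropyTime_le`). Taking `r` close to `1`, and
using that `E N` grows at least linearly in `k`, makes the ratio small uniformly in the code.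
-/

/-! ### Kraft's inequality for prefix codes -/

namespace InformationTheory

lemma uniquelyDecodable_of_prefixFree {α : Type*} {S : Set (List α)} (hnil : [] ∉ S)
    (hS : ∀ u ∈ S, ∀ v ∈ S, u <+: v → u = v) : UniquelyDecodable S := by
  intro L₁
  induction L₁ with
  | nil =>
    intro L₂ _ h₂ h
    rcases L₂ with _ | ⟨v, L₂⟩
    · rfl
    · have hv : v = [] := by simp at h; exact h.1
      exact absurd (hv ▸ h₂ v (by simp)) hnil
  | cons u L₁ ih =>
    intro L₂ h₁ h₂ h
    rcases L₂ with _ | ⟨v, L₂⟩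
    · have hu : u = [] := by simp at h; exact h.1
      exact absurd (hu ▸ h₁ u (by simp)) hnil
    · have hu := h₁ u (by simp)
      have hv := h₂ v (by simp)
      rw [List.flatten_cons, List.flatten_cons] at h
      have huv : u = v := by
        rcases List.prefix_or_prefix_of_prefix (List.prefix_append u L₁.flatten)
          (h ▸ List.prefix_append v L₂.flatten) with h' | h'
        · exact hS u hu v hv h'
        · exact (hS v hv u hu h').symm
      subst huv
      rw [ih L₂ (fun w hw => h₁ w (by simp [hw])) (fun w hw => h₂ w (by simp [hw]))
        (List.append_cancel_left h)]

/-- Kraft's inequality for prefix codes. The degenerate code consisting of the empty word alone,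
which is not uniquely decodable, is allowed. -/
lemma kraft_of_prefixFree {α : Type*} [Fintype α] [Nonempty α] {S : Finset (List α)}
    (hS : ∀ u ∈ S, ∀ v ∈ S, u <+: v → u = v) :
    ∑ w ∈ S, (1 / Fintype.card α : ℝ) ^ w.length ≤ 1 := by
  by_cases hnil : [] ∈ S
  · have : S = {[]} := Finset.eq_singleton_iff_unique_mem.2
      ⟨hnil, fun w hw => (hS [] hnil w hw List.nil_prefix).symm⟩
    simp [this]
  · exact kraft_mcmillan_inequality (uniquelyDecodable_of_prefixFree (by simpa using hnil)
      (by simpa using hS))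

end InformationTheory

/-! ### Gibbs' inequality -/

/-- One term of Gibbs' inequality between entropy and cross entropy. The linear correction sums to
zero when `p` and `q` run over the weights of probability distributions. -/
lemma neg_mul_logb_le {p q : ℝ} (hp : 0 ≤ p) (hq : 0 < q) :
    -(p * Real.logb 2 p) ≤ p * -Real.logb 2 q + (q - p) / Real.log 2 := by
  have hl : 0 < Real.log 2 := Real.log_pos (by norm_num)
  rcases hp.eq_or_lt with rfl | hp
  · simpa using div_nonneg hq.le hl.le
  · have h1 := Real.log_le_sub_one_of_pos (div_pos hq hp)
    rw [Real.log_div hq.ne' hp.ne'] at h1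
    have h2 := mul_le_mul_of_nonneg_left h1 hp.le
    rw [mul_sub p (q / p), mul_div_cancel₀ _ hp.ne', mul_one] at h2
    have h3 := div_le_div_of_nonneg_right h2 hl.le
    simp only [Real.logb]
    refine le_of_sub_nonneg ((sub_nonneg.2 h3).trans_eq ?_)
    ring

/-! ### The uniform law of the sources -/

lemma sourceLaw_singleton (k : ℕ) (x : SourceInput k) : sourceLaw k {x} = (8 ^ k : ENNReal)⁻¹ := by
  have hb (b : Fin 2) : bernoulliMeasure (1 : Fin 2) (0 : Fin 2)
      ⟨1 / 2, by norm_num, by norm_num⟩ {b} = (2 : ENNReal)⁻¹ := by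
    have h2 (h : (2⁻¹ : ℝ) ∈ unitInterval) : unitInterval.toNNReal ⟨2⁻¹, h⟩ = 2⁻¹ := by
      ext; simp
    have h2' (h : (2⁻¹ : ℝ) ∈ unitInterval) :
        unitInterval.toNNReal (unitInterval.symm ⟨2⁻¹, h⟩) = 2⁻¹ := by
      ext; simp; norm_num
    rw [bernoulliMeasure_apply _ (MeasurableSet.singleton b)]
    fin_cases b <;> simp [h2, h2']
  simp only [sourceLaw, Measure.pi_singleton, hb, Finset.prod_const, Finset.card_univ,
    Fintype.card_fin]
  rw [← pow_mul, ← ENNReal.inv_pow, mul_comm, pow_mul]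
  norm_num

instance (k : ℕ) : IsProbabilityMeasure (sourceLaw k) := by
  unfold sourceLaw; infer_instance

lemma integral_sourceLaw {k : ℕ} (f : SourceInput k → ℝ) :
    ∫ x, f x ∂(sourceLaw k) = (8 ^ k : ℝ)⁻¹ * ∑ x, f x := by
  rw [integral_fintype .of_finite, Finset.mul_sum]
  simp [Measure.real, sourceLaw_singleton]

/-- The coordinates at which the sum is `1` or `2`. These are the coordinates at which the sum
does not determine the bit of the third source. -/
def ambiguous {k : ℕ} (x : SourceInput k) : Finset (Fin k) :=
  {i | arithSum x i = 1 ∨ arithSum x i = 2}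

lemma card_filter_mem_ambiguous {k : ℕ} (i : Fin k) :
    4 * (Finset.univ.filter fun x : SourceInput k => i ∈ ambiguous x).card = 3 * 8 ^ k := by
  let T : Finset (Fin 3 → Fin 2) :=
    {y | (y 0).val + (y 1).val + (y 2).val = 1 ∨ (y 0).val + (y 1).val + (y 2).val = 2}
  have hT : T.card = 6 := by decide
  have h : (Finset.univ.filter fun x : SourceInput k => i ∈ ambiguous x).card =
      (Fintype.piFinset
        (Function.update (fun _ : Fin k => (Finset.univ : Finset (Fin 3 → Fin 2))) i T)).card := by
    refine Finset.card_equiv (Equiv.piComm _) fun x => ?_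
    simp only [Finset.mem_filter_univ, ambiguous, Fintype.mem_piFinset]
    constructor
    · intro hx j
      rcases eq_or_ne j i with rfl | hj
      · simpa [T, arithSum, Fin.ext_iff] using hx
      · simp [hj]
    · intro hx
      simpa [T, arithSum, Fin.ext_iff] using hx i
  rw [h, Fintype.card_piFinset, ← Finset.mul_prod_erase _ _ (Finset.mem_univ i)]
  have h8 : ∏ j ∈ Finset.univ.erase i,
      (Function.update (fun _ : Fin k => (Finset.univ : Finset (Fin 3 → Fin 2))) i T j).card
      = 8 ^ (k - 1) := by
    rw [Finset.prod_congr rfl (g := fun _ => 8)]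
    · simp
    · intro j hj
      simp [Finset.ne_of_mem_erase hj]
  rw [h8, Function.update_self, hT]
  obtain ⟨m, rfl⟩ : ∃ m, k = m + 1 := ⟨k - 1, by have := i.pos; omega⟩
  simp [pow_succ]; ring

lemma integral_card_ambiguous (k : ℕ) :
    ∫ x, ((ambiguous x).card : ℝ) ∂(sourceLaw k) = 3 / 4 * k := by
  have h (x : SourceInput k) : ((ambiguous x).card : ℝ) =
      ∑ i, if i ∈ ambiguous x then 1 else 0 := by simp
  rw [integral_sourceLaw]
  simp_rw [h]
  rw [Finset.sum_comm]
  have h' (i : Fin k) : (∑ x : SourceInput k, if i ∈ ambiguous x then (1 : ℝ) else 0) =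
      3 / 4 * 8 ^ k := by
    have := card_filter_mem_ambiguous i
    rw [Finset.sum_boole]
    rw [← Nat.cast_inj (R := ℝ)] at this
    push_cast at this
    linarith
  simp_rw [h']
  simp
  field_simp

namespace NetworkCode

variable {Z : Type*} {k : ℕ}

/-! ### The prefix code of received words -/

/-- The word received by the terminal up to the stopping time, over the alphabet `Z × Z`. -/
def word (c : NetworkCode Z k) (x : SourceInput k) : List (Z × Z) :=
  ((c.enc₁ (x 0) (x 2)).take (c.stopTime x)).zip ((c.enc₂ (x 1) (x 2)).take (c.stopTime x))

lemma length_word (c : NetworkCode Z k) (x : SourceInput k) :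
    (c.word x).length = c.stopTime x := by
  simp [word, c.stopTime_le₁ x, c.stopTime_le₂ x]

lemma stopTime_eq_of_take_eq (c : NetworkCode Z k) {x y : SourceInput k}
    (h₁ : (c.enc₁ (y 0) (y 2)).take (c.stopTime x) = (c.enc₁ (x 0) (x 2)).take (c.stopTime x))
    (h₂ : (c.enc₂ (y 1) (y 2)).take (c.stopTime x) = (c.enc₂ (x 1) (x 2)).take (c.stopTime x)) :
    c.stopTime y = c.stopTime x := by
  obtain ⟨f, hf⟩ := c.isStopping (c.stopTime x)
  rw [hf y, h₁, h₂, ← hf x]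

lemma map_fst_word (c : NetworkCode Z k) (x : SourceInput k) :
    (c.word x).map Prod.fst = (c.enc₁ (x 0) (x 2)).take (c.stopTime x) :=
  List.map_fst_zip (by simp [c.stopTime_le₁ x, c.stopTime_le₂ x])

lemma map_snd_word (c : NetworkCode Z k) (x : SourceInput k) :
    (c.word x).map Prod.snd = (c.enc₂ (x 1) (x 2)).take (c.stopTime x) :=
  List.map_snd_zip (by simp [c.stopTime_le₁ x, c.stopTime_le₂ x])

/-- The received words form a prefix code, because `N` is a stopping time. -/
lemma word_eq_of_prefix (c : NetworkCode Z k) {x y : SourceInput k}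
    (h : c.word x <+: c.word y) : c.word x = c.word y := by
  have hle : c.stopTime x ≤ c.stopTime y := by simpa [length_word] using h.length_le
  have hx : c.word x = (c.word y).take (c.stopTime x) := by
    simpa [length_word] using List.prefix_iff_eq_take.1 h
  have h₁ := congrArg (List.map Prod.fst) hx
  have h₂ := congrArg (List.map Prod.snd) hx
  rw [List.map_take, map_fst_word, map_fst_word, List.take_take, min_eq_left hle] at h₁
  rw [List.map_take, map_snd_word, map_snd_word, List.take_take, min_eq_left hle] at h₂
  refine h.eq_of_length ?_
  rw [length_word, length_word, c.stopTime_eq_of_take_eq h₁.symm h₂.symm]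

lemma kraft_word [Fintype Z] [Nonempty Z] [DecidableEq Z] (c : NetworkCode Z k) :
    ∑ w ∈ Finset.univ.image c.word, (1 / (Fintype.card Z : ℝ) ^ 2) ^ w.length ≤ 1 := by
  have h := InformationTheory.kraft_of_prefixFree (S := Finset.univ.image c.word) (by
    simp only [Finset.mem_image, Finset.mem_univ, true_and, forall_exists_index,
      forall_apply_eq_imp_iff]
    exact fun x y => c.word_eq_of_prefix)
  simpa [Fintype.card_prod, ← pow_two] using h

/-! ### Zero-error decoding -/

lemma ZeroError.estimate_eq {c : NetworkCode Z k} (hc : c.ZeroError) (x : SourceInput k) :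
    c.estimate x = arithSum x := by
  by_contra hx
  have := measure_mono_null (Set.singleton_subset_iff.2 hx) hc
  simp [sourceLaw_singleton] at this

lemma estimate_eq_of_take_eq (c : NetworkCode Z k) {x y : SourceInput k}
    (h₁ : (c.enc₁ (y 0) (y 2)).take (c.stopTime x) = (c.enc₁ (x 0) (x 2)).take (c.stopTime x))
    (h₂ : (c.enc₂ (y 1) (y 2)).take (c.stopTime x) = (c.enc₂ (x 1) (x 2)).take (c.stopTime x)) :
    c.estimate y = c.estimate x := by
  rw [estimate, c.stopTime_eq_of_take_eq h₁ h₂, h₁, h₂, estimate]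

lemma take_enc_eq_of_word_eq (c : NetworkCode Z k) {x y : SourceInput k}
    (h : c.word y = c.word x) :
    (c.enc₁ (y 0) (y 2)).take (c.stopTime x) = (c.enc₁ (x 0) (x 2)).take (c.stopTime x) ∧
    (c.enc₂ (y 1) (y 2)).take (c.stopTime x) = (c.enc₂ (x 1) (x 2)).take (c.stopTime x) := by
  have hN : c.stopTime y = c.stopTime x := by rw [← length_word, h, length_word]
  have h₁ := c.map_fst_word y
  have h₂ := c.map_snd_word y
  rw [h, map_fst_word, hN] at h₁
  rw [h, map_snd_word, hN] at h₂
  exact ⟨h₁.symm, h₂.symm⟩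

lemma ZeroError.arithSum_eq_of_word_eq {c : NetworkCode Z k} (hc : c.ZeroError)
    {x y : SourceInput k} (h : c.word y = c.word x) : arithSum y = arithSum x := by
  obtain ⟨h₁, h₂⟩ := c.take_enc_eq_of_word_eq h
  rw [← hc.estimate_eq, ← hc.estimate_eq, c.estimate_eq_of_take_eq h₁ h₂]

/-- For a fixed vector of the third source, the received word determines the other two. -/
lemma ZeroError.eq_of_word_eq {c : NetworkCode Z k} (hc : c.ZeroError) {x y : SourceInput k}
    (h : c.word y = c.word x) (h2 : y 2 = x 2) : y = x := by
  obtain ⟨-, h₂⟩ := c.take_enc_eq_of_word_eq h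
  -- Replacing only the vector of the second source leaves the received word unchanged.
  have hz := c.estimate_eq_of_take_eq (x := x) (y := ![x 0, y 1, x 2]) (by simp)
    (by simpa [h2] using h₂)
  rw [hc.estimate_eq, hc.estimate_eq] at hz
  have hy := hc.arithSum_eq_of_word_eq h
  have e1 : y 1 = x 1 := by
    funext i
    have := congrArg Fin.val (congrFun hz i)
    simp [arithSum] at this
    omega
  have e0 : y 0 = x 0 := by
    funext i
    have := congrArg Fin.val (congrFun hy i)
    simp [arithSum, e1, h2] at this
    omega
  funext j
  fin_cases j <;> assumption

/-- The fibre of the received word through `x` has at most `2 ^ m` points, where `m` is the number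
of coordinates at which the sum leaves the bit of the third source undetermined. -/
lemma ZeroError.card_fibre_word_le [DecidableEq Z] {c : NetworkCode Z k} (hc : c.ZeroError)
    (x : SourceInput k) :
    (Finset.univ.filter fun y => c.word y = c.word x).card ≤ 2 ^ (ambiguous x).card := by
  have hcard : (Finset.univ : Finset (ambiguous x → Fin 2)).card = 2 ^ (ambiguous x).card := by
    simp
  rw [← hcard]
  refine Finset.card_le_card_of_injOn (fun y i => y 2 i) (fun _ _ => by simp) ?_
  intro y hy z hz hyz
  simp only [Finset.coe_filter, Finset.mem_univ, true_and, Set.mem_ofPred_eq] at hy hz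
  refine hc.eq_of_word_eq (hy.trans hz.symm) ?_
  funext i
  by_cases hi : i ∈ ambiguous x
  · exact congrFun hyz ⟨i, hi⟩
  · have h1 := congrArg Fin.val (congrFun (hc.arithSum_eq_of_word_eq hy) i)
    have h2 := congrArg Fin.val (congrFun (hc.arithSum_eq_of_word_eq hz) i)
    simp only [ambiguous, Finset.mem_filter_univ, Fin.ext_iff] at hi
    simp only [arithSum, Fin.isValue, Fin.val_one, Fin.val_two] at h1 h2 hi
    omega

/-- Kraft's inequality for the received words, pulled back to the sources: each codeword is counted
at most `2 ^ m` times, with weight `2 ^ (-m)`. -/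
lemma ZeroError.sum_pow_stopTime_div_le [Fintype Z] [Nonempty Z] {c : NetworkCode Z k}
    (hc : c.ZeroError) :
    ∑ x, (1 / (Fintype.card Z : ℝ) ^ 2) ^ c.stopTime x / 2 ^ (ambiguous x).card ≤ 1 := by
  classical
  refine le_trans ?_ c.kraft_word
  rw [← Finset.sum_fiberwise_of_maps_to (g := c.word) (t := Finset.univ.image c.word) (by simp)]
  refine Finset.sum_le_sum fun w hw => ?_
  obtain ⟨x, -, rfl⟩ := Finset.mem_image.1 hw
  have h (y : SourceInput k) (hy : y ∈ Finset.univ.filter fun y => c.word y = c.word x) :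
      (1 / (Fintype.card Z : ℝ) ^ 2) ^ c.stopTime y / 2 ^ (ambiguous y).card =
        (1 / (Fintype.card Z : ℝ) ^ 2) ^ (c.word x).length / 2 ^ (ambiguous x).card := by
    have hy' : c.word y = c.word x := by simpa using hy
    rw [← length_word, hy', ambiguous, ambiguous, hc.arithSum_eq_of_word_eq hy']
  rw [Finset.sum_congr rfl h, Finset.sum_const, nsmul_eq_mul, mul_div_left_comm]
  refine mul_le_of_le_one_right (by positivity) ?_
  rw [div_le_one (by positivity)]
  exact_mod_cast hc.card_fibre_word_le x

/-! ### The converse bound on the expected stopping time -/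

/-- The expected number `2 E N log |Z|` of bits received is at least `2.25 k`. -/
lemma ZeroError.le_expTime [Fintype Z] [Nonempty Z] {c : NetworkCode Z k} (hc : c.ZeroError) :
    9 / 4 * (k : ℝ) ≤ 2 * c.expTime * Real.logb 2 (Fintype.card Z) := by
  have hZ : (0 : ℝ) < Fintype.card Z := by exact_mod_cast Fintype.card_pos
  have hl : 0 < Real.log 2 := Real.log_pos (by norm_num)
  -- Up to normalisation, `Y` is the ratio of the Kraft weight to the largest possible
  -- probability of the received word.
  let Y : SourceInput k → ℝ := fun x =>
    8 ^ k * ((1 / (Fintype.card Z : ℝ) ^ 2) ^ c.stopTime x / 2 ^ (ambiguous x).card)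
  have hlog (x : SourceInput k) : Real.log (Y x) =
      3 * k * Real.log 2 - 2 * Real.log (Fintype.card Z) * c.stopTime x
        - Real.log 2 * (ambiguous x).card := by
    have h8 : Real.log 8 = 3 * Real.log 2 := by
      rw [show (8 : ℝ) = 2 ^ 3 by norm_num, Real.log_pow]; norm_num
    simp only [Y]
    rw [Real.log_mul (by positivity) (by positivity), Real.log_div (by positivity) (by positivity),
      Real.log_pow, Real.log_pow, Real.log_pow, one_div, Real.log_inv, Real.log_pow, h8]
    push_cast; ring
  have hle : ∫ x, Real.log (Y x) ∂(sourceLaw k) ≤ ∫ x, (Y x - 1) ∂(sourceLaw k) :=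
    integral_mono .of_finite .of_finite fun x =>
      Real.log_le_sub_one_of_pos (by simp only [Y]; positivity)
  have hY : ∫ x, (Y x - 1) ∂(sourceLaw k) ≤ 0 := by
    rw [integral_sub .of_finite .of_finite, integral_sourceLaw]
    simp only [Y, ← Finset.mul_sum]
    rw [inv_mul_cancel_left₀ (by positivity)]
    simpa using hc.sum_pow_stopTime_div_le
  have hint : ∫ x, Real.log (Y x) ∂(sourceLaw k) =
      3 * k * Real.log 2 - 2 * Real.log (Fintype.card Z) * c.expTime
        - Real.log 2 * (3 / 4 * k) := by
    rw [integral_congr_ae (.of_forall hlog), integral_sub .of_finite .of_finite,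
      integral_sub .of_finite .of_finite,
      integral_const_mul (2 * Real.log (Fintype.card Z)), integral_const_mul (Real.log 2),
      integral_card_ambiguous, expTime]
    simp
  rw [hint] at hle
  rw [Real.logb, mul_div_assoc', le_div_iff₀ hl]
  linarith

/-! ### The entropy of the stopping time -/

lemma entropyTime_nonneg (c : NetworkCode Z k) : 0 ≤ c.entropyTime :=
  tsum_nonneg fun n => by
    have := Real.logb_nonpos (b := 2) (by norm_num) measureReal_nonneg
      (measureReal_le_one (μ := sourceLaw k) (s := {x | c.stopTime x = n}))
    have h0 := measureReal_nonneg (μ := sourceLaw k) (s := {x | c.stopTime x = n})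
    nlinarith

lemma sum_measureReal_stopTime_mul (c : NetworkCode Z k) (g : ℕ → ℝ) :
    ∑ n ∈ Finset.univ.image c.stopTime, (sourceLaw k).real {x | c.stopTime x = n} * g n =
      ∫ x, g (c.stopTime x) ∂(sourceLaw k) := by
  have h (n : ℕ) : (sourceLaw k).real {x | c.stopTime x = n} =
      (8 ^ k : ℝ)⁻¹ * ∑ x, if c.stopTime x = n then 1 else 0 := by
    rw [← integral_sourceLaw, ← integral_indicator_one (Set.toFinite _).measurableSet]
    simp only [Set.indicator_apply, Set.mem_ofPred_eq, Pi.one_apply]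
  simp_rw [h, integral_sourceLaw, mul_assoc]
  rw [← Finset.mul_sum, ← Finset.sum_fiberwise_of_maps_to (g := c.stopTime)
    (t := Finset.univ.image c.stopTime) (by simp)]
  congr 1
  refine Finset.sum_congr rfl fun n _ => ?_
  rw [Finset.sum_mul, Finset.sum_filter]
  refine Finset.sum_congr rfl fun x _ => ?_
  split_ifs with hx <;> simp [hx]

/-- The entropy of `N` is at most its cross entropy with the geometric law of parameter
`1 - r`. -/
lemma entropyTime_le (c : NetworkCode Z k) {r : ℝ} (hr0 : 0 < r) (hr1 : r < 1) :
    c.entropyTime ≤ c.expTime * -Real.logb 2 r + -Real.logb 2 (1 - r) := by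
  have hl : 0 < Real.log 2 := Real.log_pos (by norm_num)
  have h1r : 0 < 1 - r := by linarith
  set S := Finset.univ.image c.stopTime
  set p : ℕ → ℝ := fun n => (sourceLaw k).real {x | c.stopTime x = n}
  let q : ℕ → ℝ := fun n => (1 - r) * r ^ n
  have hq (n : ℕ) : 0 < q n := by positivity
  have hqsum : ∑ n ∈ S, q n ≤ 1 := by
    have hgeom := (hasSum_geometric_of_lt_one hr0.le hr1).mul_left (1 - r)
    rw [mul_inv_cancel₀ h1r.ne'] at hgeom
    exact sum_le_hasSum S (fun n _ => (hq n).le) hgeom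
  have hpsum : ∑ n ∈ S, p n = 1 := by
    simpa using c.sum_measureReal_stopTime_mul fun _ => 1
  have hpmean : ∑ n ∈ S, p n * n = c.expTime := c.sum_measureReal_stopTime_mul fun n => n
  have hent : c.entropyTime = ∑ n ∈ S, -(p n * Real.logb 2 (p n)) := by
    refine tsum_eq_sum fun n hn => ?_
    have : {x | c.stopTime x = n} = ∅ := by
      ext x
      simp only [Set.mem_ofPred_eq, Set.mem_empty_iff_false, iff_false]
      rintro rfl
      exact hn (Finset.mem_image_of_mem _ (Finset.mem_univ x))
    simp [this]
  have hterm (n : ℕ) : -(p n * Real.logb 2 (p n)) ≤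
      p n * n * -Real.logb 2 r + p n * -Real.logb 2 (1 - r) + (q n - p n) / Real.log 2 := by
    have h := neg_mul_logb_le (measureReal_nonneg : 0 ≤ p n) (hq n)
    simp only [q] at h ⊢
    rw [Real.logb_mul h1r.ne' (by positivity), Real.logb_pow] at h
    linarith
  rw [hent]
  refine (Finset.sum_le_sum fun n _ => hterm n).trans ?_
  rw [Finset.sum_add_distrib, Finset.sum_add_distrib, ← Finset.sum_mul, ← Finset.sum_mul,
    ← Finset.sum_div, Finset.sum_sub_distrib, hpsum, hpmean, one_mul]
  have := div_nonpos_of_nonpos_of_nonneg (sub_nonpos.2 hqsum) hl.le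
  linarith

end NetworkCode

theorem mainTheorem1 (Z : Type*) [Fintype Z] (hZ : 1 < Fintype.card Z) :
    (∀ k : ℕ, 0 < k → ∀ c : NetworkCode Z k, c.ZeroError →
      0 < c.expTime ∧
      c.rate ≤ c.entropyTime / (c.expTime * Real.logb 2 (Fintype.card Z)) + 2 / 2.25) ∧
    (∀ ε : ℝ, 0 < ε → ∃ K : ℕ, ∀ k : ℕ, K ≤ k → ∀ c : NetworkCode Z k, c.ZeroError →
      c.entropyTime / c.expTime ≤ ε) ∧
    computingCapacity Z ≤ ((8 / 9 : ℝ) : EReal) := by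
  have : Nonempty Z := Fintype.card_pos_iff.1 (by omega)
  set L := Real.logb 2 (Fintype.card Z)
  have hLpos : 0 < L := Real.logb_pos (by norm_num) (by exact_mod_cast hZ)
  have hpos {k : ℕ} (hk : 0 < k) {c : NetworkCode Z k} (hc : c.ZeroError) : 0 < c.expTime := by
    have h : 9 / 4 * (k : ℝ) ≤ 2 * c.expTime * L := hc.le_expTime
    have hk' : (0 : ℝ) < k := by exact_mod_cast hk
    by_contra! h0
    nlinarith [mul_nonneg (neg_nonneg.2 h0) hLpos.le]
  have hrate {k : ℕ} (hk : 0 < k) {c : NetworkCode Z k} (hc : c.ZeroError) :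
      c.rate ≤ 8 / 9 := by
    have h : 9 / 4 * (k : ℝ) ≤ 2 * c.expTime * L := hc.le_expTime
    rw [NetworkCode.rate, div_le_iff₀ (mul_pos (hpos hk hc) hLpos)]
    linarith
  refine ⟨fun k hk c hc => ⟨hpos hk hc, ?_⟩, fun ε hε => ?_, ?_⟩
  · have h0 : 0 ≤ c.entropyTime / (c.expTime * L) :=
      div_nonneg c.entropyTime_nonneg (mul_pos (hpos hk hc) hLpos).le
    have := hrate hk hc
    norm_num at this ⊢
    linarith
  · -- The geometric law costs `ε / 2` bits per unit of expected time, plus a constant.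
    let r : ℝ := 2 ^ (-(ε / 2))
    have hr0 : 0 < r := by positivity
    have hr1 : r < 1 := Real.rpow_lt_one_of_one_lt_of_neg (by norm_num) (by linarith)
    have hlr : Real.logb 2 r = -(ε / 2) := Real.logb_rpow (by norm_num) (by norm_num)
    obtain ⟨K, hK⟩ := exists_nat_ge (2 * -Real.logb 2 (1 - r) * L / ε)
    -- The block length `k = 0`, for which `E N = 0` is possible, has to be excluded.
    refine ⟨K + 1, fun k hk c hc => ?_⟩
    have hE := hpos (by omega) hc
    have h : 9 / 4 * (k : ℝ) ≤ 2 * c.expTime * L := hc.le_expTime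
    have hH := c.entropyTime_le hr0 hr1
    rw [hlr] at hH
    have hk' : (K : ℝ) + 1 ≤ k := by exact_mod_cast hk
    rw [div_le_iff₀ hε] at hK
    have hconst : -Real.logb 2 (1 - r) ≤ c.expTime * (ε / 2) := by
      refine le_of_mul_le_mul_right ?_ hLpos
      nlinarith
    rw [div_le_iff₀ hE]
    linarith
  · refine sSup_le ?_
    rintro _ ⟨k, hk, c, hc, rfl⟩
    exact_mod_cast hrate hk hc
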